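/- Let $d\ge 2$. A set $S\subset\mathbb R^d$ is called well-distributed if there is a constant $C>0$ such that every cube of side-length $C$ contains at least one element of $S$; a subset $A$ of $\mathbb R^d$ or of $\mathbb R$ is called separated if there is a constant $c>0$ such that $|a-a'|\ge c$ for all distinct $a,a'\in A$. For a bounded convex set $K\subset\mathbb R^d$, symmetric about the origin and with non-empty interior, let $\|x\|_K=\inf\{r>0 : x\in rK\}$ be the norm induced by $K$, let $\Delta_K(E)=\{\|x-y\|_K : x,y\in E\}$ for $E\subset\mathbb R^d$, and let $\sigma_K$ be the Lebesgue (surface) measure on $\partial K$. Let $S\subset\mathbb R^d$ be well-distributed and separated. (i) Let $K\subset\mathbb R^d$ be a bounded convex set, symmetric about the origin, with non-empty interior. Suppose that there are a constant $C$ and a convex increasing (not necessarily strictly) function $\gamma:[0,\infty)\to\mathbb R$ with $\gamma(0)=0$ such that $$\left|\int_{\partial K} e^{-2\pi i x\cdot\xi}\,d\sigma_K(x)\right|\le C\,\gamma(|\xi|^{-1})\qquad\text{for all }\xi\in\mathbb R^d\setminus\{0\}.$$ Then $\Delta_K(S)$ is not separated. (ii) Let $K\subset\mathbb R^d$ be any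 bounded convex set, symmetric about the origin, with non-empty interior. Then $\Delta_K(\rho S)$ is not separated for almost every $\rho\in SO(d)$ with respect to Haar measure. -/

import Mathlib

open MeasureTheory

noncomputable section

namespace KDistance

/-- Euclidean `d`-space with the Euclidean norm. -/
abbrev Space (d : ℕ) : Type := EuclideanSpace ℝ (Fin d)

/-- A set is well-distributed if for some `C > 0` every closed axis-parallel cube of side-length
`C` contains at least one of its points (`x` is the lower corner of the cube). -/
def WellDistributed {d : ℕ} (S : Set (Space d)) : Prop :=
  ∃ C : ℝ, 0 < C ∧ ∀ x : Space d, ∃ s ∈ S, ∀ i, x i ≤ s i ∧ s i ≤ x i + C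

/-- A set is separated if distinct points are at distance at least some fixed `c > 0`. Used both
for subsets of Euclidean space and for subsets of the real line. -/
def Separated {X : Type*} [MetricSpace X] (A : Set X) : Prop :=
  ∃ c : ℝ, 0 < c ∧ ∀ a ∈ A, ∀ a' ∈ A, a ≠ a' → c ≤ dist a a'

/-- A bounded convex set, symmetric about the origin, with non-empty interior. The last condition
is exactly what makes the gauge of `K` a norm. -/
structure IsSymmetricConvexBody {d : ℕ} (K : Set (Space d)) : Prop where
  isBounded : Bornology.IsBounded K
  convex : Convex ℝ K
  neg_mem : ∀ x ∈ K, -x ∈ K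
  interior_nonempty : (interior K).Nonempty

/-- The `K`-distance set `{‖x - y‖_K : x, y ∈ E}`, where `‖x‖_K = inf {r > 0 : x ∈ r K}`. -/
def distanceSet {d : ℕ} (K E : Set (Space d)) : Set ℝ :=
  {r | ∃ x ∈ E, ∃ y ∈ E, r = gauge K (x - y)}

/-- The Lebesgue (surface) measure on the boundary of `K`: the `(d - 1)`-dimensional Hausdorff
measure, normalized to agree with Lebesgue measure on hyperplanes, restricted to `∂K`. -/
def surfaceMeasure {d : ℕ} (K : Set (Space d)) : Measure (Space d) :=
  (μHE[d - 1] : Measure (Space d)).restrict (frontier K)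

/-- The Fourier transform `∫_{∂K} exp (-2 π i x · ξ) dσ_K(x)`. -/
def surfaceFourier {d : ℕ} (K : Set (Space d)) (ξ : Space d) : ℂ :=
  ∫ x, Complex.exp (-2 * Real.pi * Complex.I * ((inner ℝ x ξ : ℝ) : ℂ)) ∂(surfaceMeasure K)

/-- The special orthogonal group, with the topology inherited from the matrices. -/
abbrev SO (d : ℕ) : Type := Matrix.specialOrthogonalGroup (Fin d) ℝ

instance instIsTopologicalGroupSO (d : ℕ) : IsTopologicalGroup (SO d) where
  continuous_mul := by fun_prop
  continuous_inv := by
    refine Continuous.subtype_mk (f := fun A : SO d => (A : Matrix (Fin d) (Fin d) ℝ).transpose) ?_ _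
    exact continuous_subtype_val.matrix_transpose

lemma SO_transpose_mul {d : ℕ} (A : Matrix (Fin d) (Fin d) ℝ) :
    A ∈ Matrix.specialOrthogonalGroup (Fin d) ℝ ↔ A.transpose * A = 1 ∧ A.det = 1 := by
  rw [Matrix.mem_specialOrthogonalGroup_iff, Matrix.mem_orthogonalGroup_iff']

instance instCompactSpaceSO (d : ℕ) : CompactSpace (SO d) := by
  have hclosed : IsClosed {A : Matrix (Fin d) (Fin d) ℝ | A.transpose * A = 1 ∧ A.det = 1} := by
    apply IsClosed.inter
    · exact isClosed_eq (by fun_prop) continuous_const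
    · exact isClosed_eq (by fun_prop) continuous_const
  have hbox : IsCompact (Set.pi Set.univ fun _ : Fin d => Set.pi Set.univ
      fun _ : Fin d => Set.Icc (-1 : ℝ) 1) :=
    isCompact_univ_pi fun _ => isCompact_univ_pi fun _ => isCompact_Icc
  have hsub : {A : Matrix (Fin d) (Fin d) ℝ | A.transpose * A = 1 ∧ A.det = 1} ⊆
      Set.pi Set.univ fun _ : Fin d => Set.pi Set.univ fun _ : Fin d => Set.Icc (-1 : ℝ) 1 := by
    rintro A ⟨hA, -⟩ i - j -
    have h : ∑ k, A k j * A k j = 1 := by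
      have h0 := congrFun (congrFun hA j) j
      simpa [Matrix.mul_apply] using h0
    have h1 : A i j * A i j ≤ 1 := by
      rw [← h]
      exact Finset.single_le_sum (f := fun k => A k j * A k j)
        (fun k _ => mul_self_nonneg _) (Finset.mem_univ i)
    exact abs_le.mp (abs_le_one_iff_mul_self_le_one.mpr h1)
  have hcomp : IsCompact {A : Matrix (Fin d) (Fin d) ℝ | A.transpose * A = 1 ∧ A.det = 1} :=
    hbox.of_isClosed_subset hclosed hsub
  have heq : ((Matrix.specialOrthogonalGroup (Fin d) ℝ : Submonoid _) :
      Set (Matrix (Fin d) (Fin d) ℝ)) = {A | A.transpose * A = 1 ∧ A.det = 1} :=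
    Set.ext fun A => SO_transpose_mul A
  exact isCompact_iff_compactSpace.mp (heq ▸ hcomp)

instance instMeasurableSpaceSO (d : ℕ) : MeasurableSpace (SO d) := borel _

instance instBorelSpaceSO (d : ℕ) : BorelSpace (SO d) := ⟨rfl⟩

/-- The natural (Haar) measure on `SO(d)`. -/
def rotationMeasure (d : ℕ) : Measure (SO d) := Measure.haar

/-- The rotated set `ρ S = {ρ x : x ∈ S}`. -/
def rotate {d : ℕ} (ρ : SO d) (S : Set (Space d)) : Set (Space d) :=
  (fun x => WithLp.toLp 2 ((ρ : Matrix (Fin d) (Fin d) ℝ).mulVec x.ofLp)) '' S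

end KDistance

end

/-! Suppose the `K`-distances of `S` are `c`-separated. Let `n` be the gradient of the norm at a
point `θ`, and let `x` in `S` stay within bounded distance of `tθ`. As `t → ∞`, the difference `‖x -
s'‖_K - ‖x - s‖_K` tends to `n · (s - s')`, so each such number is `0` or at least `c` in absolute
value (`gap_of_hasFDerivAt`). This is very restrictive on a coarsely dense `S`: by pigeonhole,
nearby vectors with this property are proportional (`gapVectors_rigid`).

For (i), proportional gradients agree up to sign, so there are finitely many gradients and `K` is a
polytope up to its boundary. A facet has positive surface measure, so it gives an atom in the law of
`n · y` for its normal `n`. By a Wiener-type averaging argument (`measure_level_eq_zero`) the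
Fourier transform then cannot decay along `n`, whereas the bound by `γ` forces decay.

For (ii), fix one gradient `n`. A bad `ρ` puts `ρ⁻¹n` into one of countably many finite sets
depending only on `S`. Each resulting condition `ρw = n` is Haar-null, because the orbit of `n` is
infinite. -/

open Filter Topology Asymptotics

noncomputable section

namespace KDistance

/-! ### Gap vectors, and derivatives along points of `S`. -/

section Gap

variable {E : Type*} [NormedAddCommGroup E] [InnerProductSpace ℝ E]

/-- The vectors `w` whose inner products with the points of `S` form a `c`-separated set of
reals. -/
def gapVectors (S : Set E) (c : ℝ) : Set E :=
  {w | ∀ s ∈ S, ∀ s' ∈ S, inner ℝ w (s - s') = 0 ∨ c ≤ |inner ℝ w (s - s')|}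

/-- If `S` is coarsely dense, two nearby vectors of `gapVectors S c` are proportional. -/
lemma gapVectors_rigid {S : Set E} {A : ℝ} (hA : 0 < A) (hS : ∀ x, ∃ s ∈ S, ‖s - x‖ ≤ A)
    {c : ℝ} (hc : 0 < c) (M : ℝ) :
    ∃ δ > 0, ∀ w ∈ gapVectors S c, ‖w‖ ≤ M → ∀ w' ∈ gapVectors S c, ‖w' - w‖ < δ →
      ∃ a : ℝ, w' = a • w := by
  choose f hfS hf using hS
  set N : ℕ := ⌈M * A / c⌉₊ + 1 with hN
  have hNle : M * A / c + 1 ≤ N := by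
    rw [hN]; push_cast; linarith [Nat.le_ceil (M * A / c)]
  set D : ℝ := 3 * A * (2 * N + 1) + 2 * A with hD
  have hD0 : 0 < D := by positivity
  refine ⟨c / D, by positivity, fun w hw hwM w' hw' hclose => ?_⟩
  by_contra hne
  push Not at hne
  -- `a • w` is the projection of `w'` to the line of `w`; if `w = 0`, division by zero gives `a =
  -- 0`.
  set a : ℝ := inner ℝ w w' / ‖w‖ ^ 2 with ha
  set v : E := w' - a • w with hv
  have hv0 : v ≠ 0 := sub_ne_zero.mpr (hne a)
  have hwv : inner ℝ w v = 0 := by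
    rw [hv, inner_sub_right, inner_smul_right, real_inner_self_eq_norm_sq, ha]
    rcases eq_or_ne w 0 with rfl | h0
    · simp
    · have : ‖w‖ ^ 2 ≠ 0 := by positivity
      field_simp
      ring
  set u : E := ‖v‖⁻¹ • v with hu
  have hvn : 0 < ‖v‖ := norm_pos_iff.mpr hv0
  have hu1 : ‖u‖ = 1 := by rw [hu, norm_smul, norm_inv, norm_norm]; field_simp
  have hwu : inner ℝ w u = 0 := by rw [hu, inner_smul_right, hwv, mul_zero]
  have hvu : v = ‖v‖ • u := by rw [hu, smul_smul, mul_inv_cancel₀ hvn.ne', one_smul]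
  -- Points of `S` near a ray orthogonal to `w`: their products with `w` stay bounded. The spacing
  -- `3A` exceeds the total error `2A`, so distinct ones differ in the direction `u`.
  let s : ℕ → E := fun j => f ((3 * A * j) • u)
  have hs : ∀ j : ℕ, ‖s j - (3 * A * j) • u‖ ≤ A := fun j => hf _
  have hws : ∀ j, |inner ℝ w (s j)| ≤ M * A := fun j => by
    have h1 : inner ℝ w (s j) = inner ℝ w (s j - (3 * A * j) • u) := by
      rw [inner_sub_right, inner_smul_right, hwu]; ring
    rw [h1]
    exact (abs_real_inner_le_norm _ _).trans
      (mul_le_mul hwM (hs j) (norm_nonneg _) ((norm_nonneg _).trans hwM))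
  -- `2N + 2` points, but only `2N + 1` cells of length `c`; two points in one cell have equal
  -- products with `w`.
  obtain ⟨i, hi, j, hj, hij, hg⟩ := Finset.exists_ne_map_eq_of_card_lt_of_maps_to
    (s := Finset.range (2 * N + 2)) (t := Finset.Icc (-(N : ℤ)) N)
    (f := fun j => ⌊inner ℝ w (s j) / c⌋) (by simp; omega) (by
      intro j _
      have h1 := abs_le.mp (hws j)
      have h2 : inner ℝ w (s j) / c ≤ M * A / c := by gcongr; exact h1.2
      have h3 : -(M * A / c) ≤ inner ℝ w (s j) / c := by
        rw [← neg_div]; gcongr; exact h1.1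
      simp only [Finset.coe_Icc, Set.mem_Icc]
      constructor
      · rw [Int.le_floor]; push_cast; linarith
      · have : ((⌊inner ℝ w (s j) / c⌋ : ℤ) : ℝ) ≤ (N : ℤ) := by
          push_cast; linarith [Int.floor_le (inner ℝ w (s j) / c)]
        exact_mod_cast this)
  have hw0 : inner ℝ w (s i - s j) = 0 := by
    refine (hw _ (hfS _) _ (hfS _)).resolve_right (not_le.mpr ?_)
    have h := Int.abs_sub_lt_one_of_floor_eq_floor hg
    rw [← sub_div, ← inner_sub_right, abs_div, abs_of_pos hc, div_lt_one hc] at h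
    exact h
  have hdiff : ‖(s i - s j) - (3 * A * ((i : ℝ) - j)) • u‖ ≤ 2 * A := by
    have : (s i - s j) - (3 * A * ((i : ℝ) - j)) • u
        = (s i - (3 * A * i) • u) - (s j - (3 * A * j) • u) := by
      rw [mul_sub, sub_smul]; abel
    rw [this]
    exact (norm_sub_le _ _).trans (by linarith [hs i, hs j])
  have hij1 : 1 ≤ |(i : ℝ) - j| := by
    have : (1 : ℤ) ≤ |(i : ℤ) - j| := Int.one_le_abs (sub_ne_zero.mpr (by exact_mod_cast hij))
    exact_mod_cast this
  have hij2 : |(i : ℝ) - j| ≤ 2 * N + 1 := by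
    rw [Finset.mem_range] at hi hj
    have hi' : (i : ℝ) ≤ 2 * N + 1 := by exact_mod_cast Nat.lt_succ_iff.mp hi
    have hj' : (j : ℝ) ≤ 2 * N + 1 := by exact_mod_cast Nat.lt_succ_iff.mp hj
    rw [abs_le]
    constructor <;> linarith [Nat.cast_nonneg (α := ℝ) i, Nat.cast_nonneg (α := ℝ) j]
  have hnu : ‖(3 * A * ((i : ℝ) - j)) • u‖ = 3 * A * |(i : ℝ) - j| := by
    rw [norm_smul, hu1, mul_one, Real.norm_eq_abs, abs_mul, abs_of_pos (by positivity)]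
  have huij : inner ℝ u (s i - s j) ≠ 0 := by
    intro h0
    have h1 : inner ℝ u ((s i - s j) - (3 * A * ((i : ℝ) - j)) • u) = -(3 * A * ((i : ℝ) - j)) := by
      rw [inner_sub_right, inner_smul_right, h0, real_inner_self_eq_norm_sq, hu1]; ring
    have h2 := abs_real_inner_le_norm u ((s i - s j) - (3 * A * ((i : ℝ) - j)) • u)
    rw [h1, hu1, one_mul, abs_neg, abs_mul, abs_of_pos (by positivity : 0 < 3 * A)] at h2
    nlinarith
  have hw' := hw' (s i) (hfS _) (s j) (hfS _)
  have hw'e : w' = a • w + ‖v‖ • u := by rw [← hvu, hv]; abel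
  have hw'1 : inner ℝ w' (s i - s j) = ‖v‖ * inner ℝ u (s i - s j) := by
    conv_lhs => rw [hw'e]
    rw [inner_add_left, real_inner_smul_left, real_inner_smul_left, hw0]; ring
  have hw'2 : inner ℝ w' (s i - s j) = inner ℝ (w' - w) (s i - s j) := by
    rw [inner_sub_left, hw0, sub_zero]
  -- Only the nonzero `u`-component of `w'` contributes, so the gap condition forces size `c`; yet
  -- this product is at most `‖w' - w‖ * D < c`.
  have hge : c ≤ |inner ℝ w' (s i - s j)| := by
    refine hw'.resolve_left ?_
    rw [hw'1]
    exact mul_ne_zero hvn.ne' huij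
  have hsn : ‖s i - s j‖ ≤ D := by
    have h1 : s i - s j = ((s i - s j) - (3 * A * ((i : ℝ) - j)) • u)
      + (3 * A * ((i : ℝ) - j)) • u := by abel
    rw [h1]
    refine (norm_add_le _ _).trans ?_
    rw [hnu, hD]
    have : 3 * A * |(i : ℝ) - j| ≤ 3 * A * (2 * N + 1) := by gcongr
    linarith
  rw [hw'2] at hge
  have h3 := abs_real_inner_le_norm (w' - w) (s i - s j)
  have h4 : ‖w' - w‖ * ‖s i - s j‖ ≤ ‖w' - w‖ * D := by gcongr
  have h5 : ‖w' - w‖ * D < c := by rwa [lt_div_iff₀ hD0] at hclose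
  linarith

/-- The remainder is `o(1/k)` as soon as `y` is bounded. Convergence of `y` is not required, which
matters because points of `S` only approximate the ray through `θ`. -/
lemma tendsto_scaled_remainder {p : E → ℝ} {θ : E} {L : E →L[ℝ] ℝ} (hL : HasFDerivAt p L θ)
    {y : ℕ → E} {B : ℝ} (hy : ∀ k, ‖y k‖ ≤ B) :
    Tendsto (fun k : ℕ => ((k : ℝ) + 1) * (p (θ + ((k : ℝ) + 1)⁻¹ • y k) - p θ
      - L (((k : ℝ) + 1)⁻¹ • y k))) atTop (𝓝 0) := by
  have hO : (fun k : ℕ => ((k : ℝ) + 1)⁻¹ • y k) =O[atTop] fun k : ℕ => ((k : ℝ) + 1)⁻¹ := by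
    refine IsBigO.of_bound B (Eventually.of_forall fun k => ?_)
    rw [norm_smul, mul_comm]
    gcongr
    exact hy k
  have h0 : Tendsto (fun k : ℕ => ((k : ℝ) + 1)⁻¹) atTop (𝓝 0) := by
    simpa only [one_div] using tendsto_one_div_add_atTop_nhds_zero_nat (𝕜 := ℝ)
  have hlim : Tendsto (fun k : ℕ => ((k : ℝ) + 1)⁻¹ • y k) atTop (𝓝 0) := hO.trans_tendsto h0
  have h1 := ((hasFDerivAt_iff_isLittleO_nhds_zero.mp hL).comp_tendsto hlim).trans_isBigO hO
  refine h1.tendsto_div_nhds_zero.congr fun k => ?_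
  simp only [Function.comp_apply, div_inv_eq_mul]
  ring

/-- The derivative of a positively homogeneous function takes only values `0` and `≥ c` on `S - S`
when the function itself has `c`-separated values there. -/
lemma gap_of_hasFDerivAt {S : Set E} {A : ℝ} (hS : ∀ x, ∃ s ∈ S, ‖s - x‖ ≤ A) {p : E → ℝ}
    (hp : ∀ t : ℝ, 0 ≤ t → ∀ x, p (t • x) = t * p x) {θ : E} {L : E →L[ℝ] ℝ}
    (hL : HasFDerivAt p L θ) {c : ℝ}
    (hsep : ∀ x ∈ S, ∀ s ∈ S, ∀ s' ∈ S, p (x - s') - p (x - s) = 0 ∨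
      c ≤ |p (x - s') - p (x - s)|) :
    ∀ s ∈ S, ∀ s' ∈ S, L (s - s') = 0 ∨ c ≤ |L (s - s')| := by
  intro s hs s' hs'
  choose f hfS hf using hS
  let x : ℕ → E := fun k => f (((k : ℝ) + 1) • θ)
  have hx : ∀ k : ℕ, ‖x k - ((k : ℝ) + 1) • θ‖ ≤ A := fun k => hf _
  have hbd : ∀ (z : E) (k : ℕ), ‖x k - ((k : ℝ) + 1) • θ - z‖ ≤ A + ‖z‖ := fun z k =>
    (norm_sub_le _ _).trans (by linarith [hx k])
  have hpz : ∀ (z : E) (k : ℕ), p (x k - z)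
      = ((k : ℝ) + 1) * p (θ + ((k : ℝ) + 1)⁻¹ • (x k - ((k : ℝ) + 1) • θ - z)) := fun z k => by
    have hk : (k : ℝ) + 1 ≠ 0 := by positivity
    rw [← hp _ (by positivity), smul_add, smul_smul, mul_inv_cancel₀ hk, one_smul]
    congr 1; abel
  have hlim := ((tendsto_scaled_remainder hL (hbd s')).sub
    (tendsto_scaled_remainder hL (hbd s))).add_const (L (s - s'))
  rw [sub_zero, zero_add] at hlim
  have hlim' : Tendsto (fun k => p (x k - s') - p (x k - s)) atTop (𝓝 (L (s - s'))) := by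
    refine hlim.congr fun k => ?_
    rw [hpz s', hpz s]
    have hk : (k : ℝ) + 1 ≠ 0 := by positivity
    simp only [map_sub, map_smul, smul_eq_mul]
    field_simp
    ring
  have hclosed : IsClosed {y : ℝ | y = 0 ∨ c ≤ |y|} :=
    (isClosed_eq continuous_id continuous_const).union
      (isClosed_le continuous_const continuous_abs)
  exact hclosed.mem_of_tendsto hlim' (Eventually.of_forall fun k => hsep _ (hfS _) _ hs _ hs')

end Gap

/-- A well-distributed set meets all closed balls of some fixed radius. -/
lemma WellDistributed.exists_norm_sub_le {d : ℕ} {S : Set (Space d)} (hS : WellDistributed S) :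
    ∃ A > 0, ∀ x, ∃ s ∈ S, ‖s - x‖ ≤ A := by
  obtain ⟨C, hC, h⟩ := hS
  refine ⟨√(d * C ^ 2) + 1, by positivity, fun x => ?_⟩
  obtain ⟨s, hs, hsx⟩ := h x
  refine ⟨s, hs, ?_⟩
  rw [EuclideanSpace.norm_eq]
  have : ∑ i, ‖(s - x) i‖ ^ 2 ≤ d * C ^ 2 := by
    calc ∑ i, ‖(s - x) i‖ ^ 2 ≤ ∑ _i : Fin d, C ^ 2 := by
          gcongr with i
          rw [Real.norm_eq_abs, PiLp.sub_apply, abs_le]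
          constructor <;> linarith [hsx i]
      _ = d * C ^ 2 := by simp
  linarith [Real.sqrt_le_sqrt this]

/-! ### The norm of a symmetric convex body and its gradients. -/

section Body

variable {d : ℕ} {K : Set (Space d)}

lemma IsSymmetricConvexBody.mem_nhds_zero (hK : IsSymmetricConvexBody K) : K ∈ 𝓝 0 := by
  obtain ⟨x, hx⟩ := hK.interior_nonempty
  have hneg : -x ∈ interior K := by
    rw [mem_interior_iff_mem_nhds] at hx ⊢
    have h := continuous_neg.continuousAt (x := -x) |>.preimage_mem_nhds (by rwa [neg_neg])
    exact mem_of_superset h fun y hy => by simpa using hK.neg_mem _ hy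
  have h0 := hK.convex.interior hx hneg (a := 1 / 2) (b := 1 / 2) (by norm_num) (by norm_num)
    (by norm_num)
  rw [smul_neg, add_neg_cancel] at h0
  exact mem_interior_iff_mem_nhds.mp h0

lemma gauge_smul_nonneg (K : Set (Space d)) (t : ℝ) (ht : 0 ≤ t) (x : Space d) :
    gauge K (t • x) = t * gauge K x := by
  rw [gauge_smul_of_nonneg ht, smul_eq_mul]

lemma IsSymmetricConvexBody.gauge_pos_of_ne (hK : IsSymmetricConvexBody K) {x : Space d}
    (hx : x ≠ 0) : 0 < gauge K x :=
  (gauge_pos (absorbent_nhds_zero hK.mem_nhds_zero)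
    (NormedSpace.isVonNBounded_of_isBounded ℝ hK.isBounded)).mpr hx

lemma IsSymmetricConvexBody.dense_differentiableAt (hK : IsSymmetricConvexBody K) :
    Dense {x | DifferentiableAt ℝ (gauge K) x} := by
  obtain ⟨C, hC⟩ := hK.convex.lipschitz_gauge hK.mem_nhds_zero
  exact Measure.dense_of_ae (μ := (volume : Measure (Space d))) hC.ae_differentiableAt

/-- The gradients of the norm at the points of differentiability. -/
def gaugeGradients (K : Set (Space d)) : Set (Space d) :=
  {n | ∃ x ≠ 0, HasGradientAt (gauge K) n x}

/-- Euler's identity for degree one. -/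
lemma hasFDerivAt_homogeneous_self {p : Space d → ℝ}
    (hp : ∀ t : ℝ, 0 ≤ t → ∀ x, p (t • x) = t * p x) {θ : Space d} {L : Space d →L[ℝ] ℝ}
    (hL : HasFDerivAt p L θ) : L θ = p θ := by
  have hc : HasDerivAt (fun t : ℝ => t • θ) θ 1 := by
    simpa using (hasDerivAt_id (1 : ℝ)).smul_const θ
  have hL' : HasFDerivAt p L ((1 : ℝ) • θ) := by rwa [one_smul]
  have h1 : HasDerivAt (fun t : ℝ => p (t • θ)) (L θ) 1 := hL'.comp_hasDerivAt 1 hc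
  have h2 : HasDerivAt (fun t : ℝ => p (t • θ)) (p θ) 1 := by
    have h3 : HasDerivAt (fun t : ℝ => t * p θ) (p θ) 1 := by
      simpa using (hasDerivAt_id (1 : ℝ)).mul_const (p θ)
    refine h3.congr_of_eventuallyEq ?_
    filter_upwards [eventually_ge_nhds (zero_lt_one' ℝ)] with t ht
    exact hp t ht θ
  exact h1.unique h2

lemma hasFDerivAt_sublinear_le {p : Space d → ℝ}
    (hp : ∀ t : ℝ, 0 ≤ t → ∀ x, p (t • x) = t * p x) (hadd : ∀ x y, p (x + y) ≤ p x + p y)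
    {θ : Space d} {L : Space d →L[ℝ] ℝ} (hL : HasFDerivAt p L θ) (x : Space d) : L x ≤ p x := by
  have hlim := tendsto_scaled_remainder hL (y := fun _ => x) (fun _ => le_rfl)
  refine sub_nonneg.mp (le_of_tendsto hlim (Eventually.of_forall fun k => ?_))
  have hk : 0 < (k : ℝ) + 1 := by positivity
  have h1 := hadd θ (((k : ℝ) + 1)⁻¹ • x)
  rw [hp _ (by positivity) x] at h1
  have h2 : ((k : ℝ) + 1) * (p (θ + ((k : ℝ) + 1)⁻¹ • x) - p θ - L (((k : ℝ) + 1)⁻¹ • x))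
      ≤ ((k : ℝ) + 1) * (((k : ℝ) + 1)⁻¹ * p x - L (((k : ℝ) + 1)⁻¹ • x)) := by
    gcongr; linarith
  refine h2.trans_eq ?_
  rw [map_smul, smul_eq_mul]
  field_simp

end Body

lemma finite_of_isBounded_of_separated {X : Type*} [MetricSpace X] [ProperSpace X] {A : Set X}
    (hA : Bornology.IsBounded A) {δ : ℝ} (hδ : 0 < δ)
    (h : ∀ x ∈ A, ∀ y ∈ A, dist x y < δ → x = y) : A.Finite := by
  by_contra hinf
  obtain ⟨x, -, hx⟩ := Set.Infinite.exists_accPt_of_subset_isCompact hinf hA.isCompact_closure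
    subset_closure
  rw [accPt_iff_nhds] at hx
  obtain ⟨y, ⟨hy, hyA⟩, hyx⟩ := hx _ (Metric.ball_mem_nhds x (half_pos hδ))
  obtain ⟨z, ⟨hz, hzA⟩, hzx⟩ := hx _ (Metric.ball_mem_nhds x (dist_pos.mpr hyx))
  refine absurd (h y hyA z hzA ?_) ?_
  · have h1 : dist z x < dist y x := hz
    have h2 : dist y x < δ / 2 := hy
    linarith [dist_triangle_right y z x]
  · rintro rfl
    exact lt_irrefl _ (Metric.mem_ball.mp hz)

/-- By rigidity, close vectors of the sphere are equal or opposite, and opposite ones are `2r`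
apart. -/
lemma finite_gapVectors_norm_eq {d : ℕ} {S : Set (Space d)} {A : ℝ} (hA : 0 < A)
    (hS : ∀ x, ∃ s ∈ S, ‖s - x‖ ≤ A) {c : ℝ} (hc : 0 < c) {r : ℝ} (hr : 0 < r) :
    {w ∈ gapVectors S c | ‖w‖ = r}.Finite := by
  obtain ⟨δ, hδ, h⟩ := gapVectors_rigid hA hS hc r
  refine finite_of_isBounded_of_separated (δ := min δ r) ?_ (by positivity) ?_
  · exact (isBounded_iff_forall_norm_le).mpr ⟨r, fun w hw => hw.2.le⟩
  · rintro x ⟨hx, hxr⟩ y ⟨hy, hyr⟩ hxy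
    rw [dist_comm, dist_eq_norm, lt_min_iff] at hxy
    obtain ⟨a, rfl⟩ := h x hx hxr.le y hy hxy.1
    rw [norm_smul, hxr, Real.norm_eq_abs, mul_eq_right₀ hr.ne'] at hyr
    rcases eq_or_eq_neg_of_abs_eq hyr with rfl | rfl
    · rw [one_smul]
    · have h1 : (-1 : ℝ) • x - x = (-2 : ℝ) • x := by module
      rw [h1, norm_smul, hxr] at hxy
      norm_num at hxy
      linarith [hxy.2]

/-! ### Finitely many gradients: the polytope case. -/

section Body

variable {d : ℕ} {K : Set (Space d)}

lemma gaugeGradients_inner_self {n x : Space d} (h : HasGradientAt (gauge K) n x) :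
    inner ℝ n x = gauge K x :=
  hasFDerivAt_homogeneous_self (gauge_smul_nonneg K) h.hasFDerivAt

lemma IsSymmetricConvexBody.inner_le_gauge (hK : IsSymmetricConvexBody K) {n : Space d}
    (hn : n ∈ gaugeGradients K) (y : Space d) : inner ℝ n y ≤ gauge K y := by
  obtain ⟨x, -, hx⟩ := hn
  exact hasFDerivAt_sublinear_le (gauge_smul_nonneg K)
    (gauge_add_le hK.convex (absorbent_nhds_zero hK.mem_nhds_zero)) hx.hasFDerivAt y

lemma IsSymmetricConvexBody.ne_zero_of_mem_gaugeGradients (hK : IsSymmetricConvexBody K)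
    {n : Space d} (hn : n ∈ gaugeGradients K) : n ≠ 0 := by
  rintro rfl
  obtain ⟨x, hx0, hx⟩ := hn
  have := hK.gauge_pos_of_ne hx0
  rw [← gaugeGradients_inner_self hx, inner_zero_left] at this
  exact lt_irrefl _ this

lemma gaugeGradients_subset_gapVectors {S : Set (Space d)} {A : ℝ}
    (hS : ∀ x, ∃ s ∈ S, ‖s - x‖ ≤ A) {c : ℝ}
    (hsep : ∀ a ∈ distanceSet K S, ∀ a' ∈ distanceSet K S, a ≠ a' → c ≤ dist a a') :
    gaugeGradients K ⊆ gapVectors S c := by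
  rintro n ⟨θ, -, hn⟩
  refine gap_of_hasFDerivAt hS (gauge_smul_nonneg K) hn.hasFDerivAt fun x hx s hs s' hs' => ?_
  by_cases h : gauge K (x - s') = gauge K (x - s)
  · exact Or.inl (sub_eq_zero.mpr h)
  · exact Or.inr (hsep _ ⟨x, hx, s', hs', rfl⟩ _ ⟨x, hx, s, hs, rfl⟩ h)

/-- Proportional gradients of the norm agree up to sign. -/
lemma IsSymmetricConvexBody.abs_eq_one_of_smul_mem (hK : IsSymmetricConvexBody K) {n : Space d}
    {a : ℝ} (hn : n ∈ gaugeGradients K) (han : a • n ∈ gaugeGradients K) : |a| = 1 := by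
  have key : ∀ m ∈ gaugeGradients K, ∀ b : ℝ, b • m ∈ gaugeGradients K → |b| ≤ 1 := by
    rintro m ⟨x, hx0, hx⟩ b hb
    have hpos := hK.gauge_pos_of_ne hx0
    -- At `x` the functional of `m` attains the norm, so testing `b • m` at `±x` bounds `±b`.
    have h1 := hK.inner_le_gauge hb x
    have h2 := hK.inner_le_gauge hb (-x)
    rw [gauge_neg hK.neg_mem, inner_neg_right] at h2
    rw [real_inner_smul_left, gaugeGradients_inner_self hx] at h1 h2
    rw [abs_le]
    constructor <;> nlinarith
  refine le_antisymm (key n hn a han) ?_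
  have ha : a ≠ 0 := by
    rintro rfl
    exact hK.ne_zero_of_mem_gaugeGradients han (zero_smul _ _)
  have h := key (a • n) han a⁻¹ (by rwa [smul_smul, inv_mul_cancel₀ ha, one_smul])
  rw [abs_inv] at h
  exact (inv_le_one₀ (abs_pos.mpr ha)).mp h

lemma IsSymmetricConvexBody.exists_norm_bounds (hK : IsSymmetricConvexBody K) :
    ∃ m > 0, ∃ M, ∀ n ∈ gaugeGradients K, m ≤ ‖n‖ ∧ ‖n‖ ≤ M := by
  obtain ⟨C, hC⟩ := hK.convex.lipschitz_gauge hK.mem_nhds_zero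
  obtain ⟨R, hR, hKR⟩ := hK.isBounded.subset_closedBall_lt 0 0
  refine ⟨R⁻¹, by positivity, C, ?_⟩
  intro n hn
  have hn0 : 0 < ‖n‖ := norm_pos_iff.mpr (hK.ne_zero_of_mem_gaugeGradients hn)
  constructor
  · obtain ⟨x, hx0, hx⟩ := hn
    have h1 := le_gauge_of_subset_closedBall (x := x)
      (absorbent_nhds_zero hK.mem_nhds_zero) hR.le hKR
    rw [← gaugeGradients_inner_self hx] at h1
    have h2 := h1.trans (real_inner_le_norm n x)
    have hxp : 0 < ‖x‖ := norm_pos_iff.mpr hx0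
    rw [div_eq_inv_mul] at h2
    exact le_of_mul_le_mul_right h2 hxp
  · have h1 := hK.inner_le_gauge hn n
    have h2 := hC.dist_le_mul n 0
    rw [gauge_zero, dist_zero_right, dist_zero_right, Real.norm_of_nonneg (gauge_nonneg _)] at h2
    rw [real_inner_self_eq_norm_mul_norm] at h1
    exact le_of_mul_le_mul_right (h1.trans h2) hn0

lemma IsSymmetricConvexBody.finite_gaugeGradients (hK : IsSymmetricConvexBody K)
    {S : Set (Space d)} {A : ℝ} (hA : 0 < A) (hS : ∀ x, ∃ s ∈ S, ‖s - x‖ ≤ A) {c : ℝ}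
    (hc : 0 < c) (hsub : gaugeGradients K ⊆ gapVectors S c) : (gaugeGradients K).Finite := by
  obtain ⟨m, hm, M, hmM⟩ := hK.exists_norm_bounds
  obtain ⟨δ, hδ, h⟩ := gapVectors_rigid hA hS hc M
  refine finite_of_isBounded_of_separated (δ := min δ m) ?_ (by positivity) ?_
  · exact (isBounded_iff_forall_norm_le).mpr ⟨M, fun w hw => (hmM w hw).2⟩
  · intro x hx y hy hxy
    rw [dist_comm, dist_eq_norm, lt_min_iff] at hxy
    obtain ⟨a, rfl⟩ := h x (hsub hx) (hmM x hx).2 y (hsub hy) hxy.1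
    rcases eq_or_eq_neg_of_abs_eq (hK.abs_eq_one_of_smul_mem hx hy) with rfl | rfl
    · rw [one_smul]
    · have h1 : (-1 : ℝ) • x - x = (-2 : ℝ) • x := by module
      rw [h1, norm_smul] at hxy
      norm_num at hxy
      linarith [hxy.2, (hmM x hx).1]

lemma IsSymmetricConvexBody.gaugeGradients_nonempty [Nontrivial (Space d)]
    (hK : IsSymmetricConvexBody K) : (gaugeGradients K).Nonempty := by
  obtain ⟨x, hx, hx0⟩ := (hK.dense_differentiableAt.sdiff_singleton 0).nonempty
  exact ⟨_, x, hx0, hx.hasGradientAt⟩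

lemma IsSymmetricConvexBody.isClosed_gauge_eq_inner (hK : IsSymmetricConvexBody K)
    (n : Space d) : IsClosed {x | gauge K x = inner ℝ n x} :=
  isClosed_eq (continuous_gauge hK.convex hK.mem_nhds_zero) (by fun_prop)

/-- If the norm has finitely many gradients, it is the maximum of the corresponding linear
functionals. -/
lemma IsSymmetricConvexBody.exists_gauge_eq_inner [Nontrivial (Space d)]
    (hK : IsSymmetricConvexBody K) (hfin : (gaugeGradients K).Finite) (x : Space d) :
    ∃ n ∈ gaugeGradients K, gauge K x = inner ℝ n x := by
  -- A finite union of closed sets, dense because the Lipschitz gauge is differentiable on a dense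
  -- set (Rademacher).
  have hclosed : IsClosed (⋃ n ∈ gaugeGradients K, {x | gauge K x = inner ℝ n x}) :=
    hfin.isClosed_biUnion fun n _ => hK.isClosed_gauge_eq_inner n
  have hdense : Dense (⋃ n ∈ gaugeGradients K, {x | gauge K x = inner ℝ n x}) := by
    refine (hK.dense_differentiableAt.sdiff_singleton 0).mono ?_
    rintro y ⟨hy, hy0⟩
    exact Set.mem_biUnion ⟨y, hy0, hy.hasGradientAt⟩
      (gaugeGradients_inner_self hy.hasGradientAt).symm
  have hx : x ∈ ⋃ n ∈ gaugeGradients K, {x | gauge K x = inner ℝ n x} := by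
    rw [← hclosed.closure_eq]; exact hdense x
  simpa using hx

/-- By Baire, one of the finitely many closed sets where the norm is linear has interior;
homogeneity moves a ball in it to level `1`, giving a piece of a facet. -/
lemma IsSymmetricConvexBody.exists_flat_ball [Nontrivial (Space d)]
    (hK : IsSymmetricConvexBody K) (hfin : (gaugeGradients K).Finite) :
    ∃ n ∈ gaugeGradients K, ∃ x, inner ℝ n x = 1 ∧ ∃ r > 0, ∀ y ∈ Metric.ball x r,
      gauge K y = inner ℝ n y := by
  have : Countable (gaugeGradients K) := hfin.countable
  obtain ⟨⟨n, hn⟩, hint⟩ := nonempty_interior_of_iUnion_of_closed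
    (f := fun n : gaugeGradients K => {x | gauge K x = inner ℝ (n : Space d) x})
    (fun n => hK.isClosed_gauge_eq_inner n) (by
      rw [Set.eq_univ_iff_forall]
      intro x
      obtain ⟨n, hn, hx⟩ := hK.exists_gauge_eq_inner hfin x
      exact Set.mem_iUnion.mpr ⟨⟨n, hn⟩, hx⟩)
  obtain ⟨z, hz, hz0⟩ := ((dense_compl_singleton (0 : Space d)).inter_open_nonempty _
    isOpen_interior hint)
  obtain ⟨r, hr, hball⟩ := Metric.mem_nhds_iff.mp (mem_interior_iff_mem_nhds.mp hz)
  have hpos := hK.gauge_pos_of_ne hz0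
  have hzn : gauge K z = inner ℝ n z := hball (Metric.mem_ball_self hr)
  refine ⟨n, hn, (gauge K z)⁻¹ • z, ?_, (gauge K z)⁻¹ * r, by positivity, fun y hy => ?_⟩
  · rw [inner_smul_right, ← hzn, inv_mul_cancel₀ hpos.ne']
  · have hy' : gauge K z • y ∈ Metric.ball z r := by
      rw [mem_ball_iff_norm] at hy ⊢
      have h1 : gauge K z • y - z = gauge K z • (y - (gauge K z)⁻¹ • z) := by
        rw [smul_sub, smul_smul, mul_inv_cancel₀ hpos.ne', one_smul]
      rw [h1, norm_smul, Real.norm_of_nonneg hpos.le]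
      rwa [← lt_inv_mul_iff₀ hpos]
    have h2 : gauge K (gauge K z • y) = inner ℝ n (gauge K z • y) := hball hy'
    rw [gauge_smul_nonneg K _ hpos.le, inner_smul_right] at h2
    exact mul_left_cancel₀ hpos.ne' h2

end Body

/-! ### Hausdorff measure on hyperplanes. -/

/-- The hyperplane through `x₀` orthogonal to `n` is isometrically parametrized by a Euclidean space
of one dimension less. -/
lemma exists_isometry_range_eq {d : ℕ} (hd : 1 ≤ d) {n x₀ : Space d} (hn : n ≠ 0) :
    ∃ f : Space (d - 1) → Space d, Isometry f ∧ f 0 = x₀ ∧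
      Set.range f = {x | inner ℝ n x = inner ℝ n x₀} := by
  have : Fact (Module.finrank ℝ (Space d) = (d - 1) + 1) := ⟨by simp; omega⟩
  have hrank : Module.finrank ℝ (ℝ ∙ n)ᗮ = d - 1 := Submodule.finrank_orthogonal_span_singleton hn
  let e : (ℝ ∙ n)ᗮ ≃ₗᵢ[ℝ] Space (d - 1) :=
    ((stdOrthonormalBasis ℝ (ℝ ∙ n)ᗮ).reindex (finCongr hrank)).repr
  refine ⟨fun y => x₀ + (e.symm y : Space d), ?_, by simp, ?_⟩
  · refine Isometry.of_dist_eq fun x y => ?_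
    rw [dist_add_left, ← Subtype.dist_eq, e.symm.dist_map]
  · ext x
    simp only [Set.mem_range, Set.mem_ofPred_eq]
    constructor
    · rintro ⟨y, rfl⟩
      rw [inner_add_right, Submodule.mem_orthogonal_singleton_iff_inner_right.mp (e.symm y).2,
        add_zero]
    · intro hx
      have hmem : x - x₀ ∈ (ℝ ∙ n)ᗮ := by
        rw [Submodule.mem_orthogonal_singleton_iff_inner_right, inner_sub_right, hx, sub_self]
      exact ⟨e ⟨x - x₀, hmem⟩, by simp⟩

lemma euclideanHausdorffMeasure_hyperplane_inter_ball_pos {d : ℕ} (hd : 1 ≤ d) {n x₀ : Space d}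
    (hn : n ≠ 0) {r : ℝ} (hr : 0 < r) :
    0 < (μHE[d - 1] : Measure (Space d)) ({x | inner ℝ n x = inner ℝ n x₀} ∩ Metric.ball x₀ r) := by
  obtain ⟨f, hf, hf0, hrange⟩ := exists_isometry_range_eq hd (x₀ := x₀) hn
  rw [← hrange, Set.inter_comm, ← hf.euclideanHausdorffMeasure_preimage, ← hf0,
    hf.preimage_ball, EuclideanSpace.euclideanHausdorffMeasure_eq_volume]
  exact Metric.measure_ball_pos _ _ hr

lemma euclideanHausdorffMeasure_hyperplane_inter_lt_top {d : ℕ} (hd : 1 ≤ d) {n : Space d}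
    (hn : n ≠ 0) (a : ℝ) {B : Set (Space d)} (hB : Bornology.IsBounded B) :
    (μHE[d - 1] : Measure (Space d)) ({x | inner ℝ n x = a} ∩ B) < ⊤ := by
  have hn2 : inner ℝ n n ≠ 0 := inner_self_ne_zero.mpr hn
  obtain ⟨f, hf, -, hrange⟩ := exists_isometry_range_eq hd (x₀ := (a / inner ℝ n n) • n) hn
  rw [inner_smul_right, div_mul_cancel₀ _ hn2] at hrange
  rw [← hrange, Set.inter_comm, ← hf.euclideanHausdorffMeasure_preimage,
    EuclideanSpace.euclideanHausdorffMeasure_eq_volume]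
  exact (hf.antilipschitz.isBounded_preimage hB).measure_lt_top

/-! ### Atoms detected by Cesàro means of a Fourier transform. -/

lemma norm_geom_sum_le {z : ℂ} (hz : ‖z‖ = 1) (hz1 : z ≠ 1) (N : ℕ) :
    ‖∑ k ∈ Finset.range N, z ^ k‖ ≤ 2 / ‖z - 1‖ := by
  rw [geom_sum_eq hz1, norm_div]
  gcongr
  refine (norm_sub_le _ _).trans ?_
  rw [norm_pow, hz, one_pow, norm_one]
  norm_num

lemma tendsto_cesaro_pow {z : ℂ} (hz : ‖z‖ = 1) :
    Tendsto (fun N : ℕ => (N⁻¹ : ℝ) • ∑ k ∈ Finset.range N, z ^ k) atTop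
      (𝓝 (if z = 1 then 1 else 0)) := by
  split_ifs with h
  · subst h
    simpa using (tendsto_const_nhds (x := (1 : ℂ))).cesaro_smul (u := fun _ => (1 : ℂ))
  · refine squeeze_zero_norm (a := fun N : ℕ => (N⁻¹ : ℝ) * (2 / ‖z - 1‖)) (fun N => ?_) ?_
    · rw [norm_smul, norm_inv, RCLike.norm_natCast]
      gcongr
      exact norm_geom_sum_le hz h N
    · simpa using (tendsto_inv_atTop_nhds_zero_nat (𝕜 := ℝ)).mul_const (2 / ‖z - 1‖)

/-- If `φ` takes values in `[-1, 1]` almost everywhere and the Fourier transform of its law tends to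
zero along multiples of `1 / 4`, then `φ` has no atom at the value `1`. -/
lemma measure_level_eq_zero {X : Type*} [MeasurableSpace X] (μ : Measure X) [IsFiniteMeasure μ]
    {φ : X → ℝ} (hφ : Measurable φ) (hb : ∀ᵐ x ∂μ, |φ x| ≤ 1)
    (hlim : Tendsto (fun k : ℕ => ∫ x, Complex.exp (-2 * Real.pi * Complex.I *
      (((k / 4 : ℝ) * φ x : ℝ) : ℂ)) ∂μ) atTop (𝓝 0)) :
    μ {x | φ x = 1} = 0 := by
  -- The factor `1/4` puts `(1 - φ)/4` in `[0, 1/2]`, so `e = 1` only at `φ = 1`; with `1/2` the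
  -- value `φ = -1` would count too.
  let e : X → ℂ := fun x => Complex.exp (((2 * Real.pi * (4⁻¹ * (1 - φ x)) : ℝ) : ℂ) * Complex.I)
  have he1 : ∀ x, ‖e x‖ = 1 := fun x => Complex.norm_exp_ofReal_mul_I _
  have hem : Measurable e := by fun_prop
  have heone : ∀ x, |φ x| ≤ 1 → (e x = 1 ↔ φ x = 1) := fun x hx => by
    constructor
    · intro h
      obtain ⟨m, hm⟩ := Complex.exp_eq_one_iff.mp h
      have hm' : (2 * Real.pi * (4⁻¹ * (1 - φ x)) : ℝ) = m * (2 * Real.pi) := by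
        have h2 := congrArg Complex.im hm
        simpa using h2
      have hpi := Real.pi_pos
      have hm2 : 4⁻¹ * (1 - φ x) = m := by
        have h3 : 2 * Real.pi * (4⁻¹ * (1 - φ x)) = 2 * Real.pi * m := by rw [hm']; ring
        exact mul_left_cancel₀ (by positivity) h3
      rw [abs_le] at hx
      have h4 : (m : ℝ) < 1 := by rw [← hm2]; linarith
      have h5 : (-1 : ℝ) < m := by rw [← hm2]; linarith
      have h6 : m = 0 := by
        have h4' : m < 1 := by exact_mod_cast h4
        have h5' : -1 < m := by exact_mod_cast h5
        omega
      rw [h6] at hm2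
      push_cast at hm2
      linarith
    · intro h
      simp [e, h]
  -- The means of `e ^ k` converge to the indicator of `e = 1`; by decay of the Fourier transform
  -- their integrals also tend to `0`.
  have hDCT : Tendsto (fun N : ℕ => ∫ x, (N⁻¹ : ℝ) • ∑ k ∈ Finset.range N, e x ^ k ∂μ) atTop
      (𝓝 (∫ x, (if e x = 1 then 1 else 0 : ℂ) ∂μ)) := by
    refine tendsto_integral_of_dominated_convergence (fun _ => 1) (fun N => by fun_prop)
      (integrable_const _) (fun N => Eventually.of_forall fun x => ?_)
      (Eventually.of_forall fun x => tendsto_cesaro_pow (he1 x))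
    rw [norm_smul, norm_inv, RCLike.norm_natCast]
    rcases N.eq_zero_or_pos with rfl | hN
    · simp
    · rw [inv_mul_le_one₀ (by positivity)]
      refine (norm_sum_le _ _).trans ?_
      simp [he1]
  have hint : ∀ k : ℕ, Integrable (fun x => e x ^ k) μ := fun k =>
    Integrable.of_bound (by fun_prop) 1 (Eventually.of_forall fun x => by simp [he1])
  have hterm : ∀ k : ℕ, ∫ x, e x ^ k ∂μ
      = Complex.exp (((2 * Real.pi * (k / 4) : ℝ) : ℂ) * Complex.I) *
        ∫ x, Complex.exp (-2 * Real.pi * Complex.I * (((k / 4 : ℝ) * φ x : ℝ) : ℂ)) ∂μ := by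
    intro k
    rw [← integral_const_mul]
    congr 1
    funext x
    simp only [e]
    rw [← Complex.exp_nat_mul, ← Complex.exp_add]
    congr 1
    push_cast
    ring
  have hterm0 : Tendsto (fun k : ℕ => ∫ x, e x ^ k ∂μ) atTop (𝓝 0) := by
    rw [tendsto_zero_iff_norm_tendsto_zero] at hlim ⊢
    refine hlim.congr fun k => ?_
    rw [hterm, norm_mul, Complex.norm_exp_ofReal_mul_I, one_mul]
  have hces : Tendsto (fun N : ℕ => ∫ x, (N⁻¹ : ℝ) • ∑ k ∈ Finset.range N, e x ^ k ∂μ) atTop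
      (𝓝 0) := by
    refine hterm0.cesaro_smul.congr fun N => ?_
    rw [integral_smul, integral_finsetSum _ fun k _ => hint k]
  have h0 := tendsto_nhds_unique hDCT hces
  have hset : MeasurableSet {x | e x = 1} := hem (measurableSet_singleton 1)
  have h1 : ∫ x, (if e x = 1 then 1 else 0 : ℂ) ∂μ = (μ.real {x | e x = 1} : ℂ) := by
    have h2 := integral_indicator_const (μ := μ) (1 : ℂ) hset
    rw [Complex.real_smul, mul_one] at h2
    rw [← h2]
    congr 1
  rw [h1, Complex.ofReal_eq_zero, measureReal_eq_zero_iff] at h0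
  rw [← h0]
  refine measure_congr ?_
  filter_upwards [hb] with x hx
  exact propext (heone x hx).symm

/-! ### Rotations, infinite orbits and null sets in `SO(d)`. -/

/-- The action of a rotation on a vector. -/
def rotateVec {d : ℕ} (ρ : SO d) (x : Space d) : Space d :=
  WithLp.toLp 2 ((ρ : Matrix (Fin d) (Fin d) ℝ).mulVec x.ofLp)

lemma rotateVec_mul {d : ℕ} (g ρ : SO d) (x : Space d) :
    rotateVec (g * ρ) x = rotateVec g (rotateVec ρ x) := by
  simp [rotateVec, Matrix.mulVec_mulVec]

lemma rotateVec_one {d : ℕ} (x : Space d) : rotateVec (1 : SO d) x = x := by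
  simp [rotateVec]

lemma rotateVec_rotateVec_inv {d : ℕ} (ρ : SO d) (x : Space d) :
    rotateVec ρ (rotateVec ρ⁻¹ x) = x := by
  rw [← rotateVec_mul, mul_inv_cancel, rotateVec_one]

lemma rotateVec_sub {d : ℕ} (ρ : SO d) (x y : Space d) :
    rotateVec ρ (x - y) = rotateVec ρ x - rotateVec ρ y := by
  simp [rotateVec, Matrix.mulVec_sub]

lemma inner_rotateVec {d : ℕ} (ρ : SO d) (x y : Space d) :
    inner ℝ (rotateVec ρ x) (rotateVec ρ y) = inner ℝ x y := by
  have h := ((SO_transpose_mul (ρ : Matrix (Fin d) (Fin d) ℝ)).mp ρ.2).1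
  simp only [EuclideanSpace.inner_eq_star_dotProduct, rotateVec, star_trivial]
  rw [Matrix.dotProduct_mulVec, Matrix.vecMul_mulVec, ← Matrix.mulVec_transpose,
    Matrix.transpose_mul, Matrix.transpose_transpose, h, Matrix.one_mulVec]

lemma norm_rotateVec {d : ℕ} (ρ : SO d) (x : Space d) : ‖rotateVec ρ x‖ = ‖x‖ := by
  rw [norm_eq_sqrt_real_inner, norm_eq_sqrt_real_inner, inner_rotateVec]

lemma exists_norm_sub_le_rotate {d : ℕ} {S : Set (Space d)} {A : ℝ}
    (hS : ∀ x, ∃ s ∈ S, ‖s - x‖ ≤ A) (ρ : SO d) (x : Space d) :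
    ∃ s ∈ rotate ρ S, ‖s - x‖ ≤ A := by
  obtain ⟨s, hs, h⟩ := hS (rotateVec ρ⁻¹ x)
  refine ⟨rotateVec ρ s, ⟨s, hs, rfl⟩, ?_⟩
  rwa [← rotateVec_rotateVec_inv ρ x, ← rotateVec_sub, norm_rotateVec]

lemma rotateVec_inv_mem_gapVectors {d : ℕ} {S : Set (Space d)} {ρ : SO d} {n : Space d} {c : ℝ}
    (h : n ∈ gapVectors (rotate ρ S) c) : rotateVec ρ⁻¹ n ∈ gapVectors S c := by
  intro s hs s' hs'
  have h1 := h (rotateVec ρ s) ⟨s, hs, rfl⟩ (rotateVec ρ s') ⟨s', hs', rfl⟩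
  rwa [← rotateVec_sub, ← rotateVec_rotateVec_inv ρ n, inner_rotateVec] at h1

open Matrix in
/-- The matrix of the reflection in the hyperplane orthogonal to `u`. -/
def householder {d : ℕ} (u : Fin d → ℝ) : Matrix (Fin d) (Fin d) ℝ :=
  1 - (2 / (u ⬝ᵥ u)) • vecMulVec u u

open Matrix in
lemma householder_transpose_mul {d : ℕ} {u : Fin d → ℝ} (hu : u ≠ 0) :
    (householder u)ᵀ * householder u = 1 := by
  have h0 : u ⬝ᵥ u ≠ 0 := by simpa using hu
  have ht : (householder u)ᵀ = householder u := by
    simp [householder, transpose_vecMulVec]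
  rw [ht, householder, sub_mul, mul_sub, mul_sub, one_mul, mul_one, one_mul, smul_mul_smul_comm,
    vecMulVec_mul_vecMulVec, vecMulVec_smul, smul_smul]
  rw [show 2 / (u ⬝ᵥ u) * (2 / (u ⬝ᵥ u)) * (u ⬝ᵥ u) = 2 / (u ⬝ᵥ u) + 2 / (u ⬝ᵥ u) by
    field_simp; ring]
  rw [add_smul]
  abel

open Matrix in
lemma det_householder {d : ℕ} {u : Fin d → ℝ} (hu : u ≠ 0) : (householder u).det = -1 := by
  have h0 : u ⬝ᵥ u ≠ 0 := by simpa using hu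
  have h1 : householder u = 1 + replicateCol Unit (-(2 / (u ⬝ᵥ u)) • u) * replicateRow Unit u := by
    rw [householder, ← vecMulVec_eq, smul_vecMulVec, neg_smul, sub_eq_add_neg]
  rw [h1, det_one_add_replicateCol_mul_replicateRow, dotProduct_smul, smul_eq_mul]
  field_simp
  ring

open Matrix in
lemma householder_mulVec {d : ℕ} (u x : Fin d → ℝ) :
    householder u *ᵥ x = x - (2 * (u ⬝ᵥ x) / (u ⬝ᵥ u)) • u := by
  rw [householder, sub_mulVec, one_mulVec, smul_mulVec, vecMulVec_mulVec]
  ext i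
  simp
  ring

/-- The composition of two hyperplane reflections. -/
def reflectionPair {d : ℕ} {u v : Fin d → ℝ} (hu : u ≠ 0) (hv : v ≠ 0) : SO d :=
  ⟨householder u * householder v, by
    rw [SO_transpose_mul, Matrix.transpose_mul, Matrix.det_mul, det_householder hu,
      det_householder hv, Matrix.mul_assoc, ← Matrix.mul_assoc _ (householder u),
      householder_transpose_mul hu, Matrix.one_mul, householder_transpose_mul hv]
    norm_num⟩

open Matrix in
-- Take `u k = e_i + kσ e_j` with `x i ≠ 0`. The sign `σ` keeps `u k · x` nonzero, so the
-- displacement of `x` is a nonzero multiple of `u k`; its `i`-coordinate reveals the multiple and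
-- its `j`-coordinate reveals `k`.
lemma exists_injective_householder {d : ℕ} (hd : 2 ≤ d) {x : Fin d → ℝ} (hx : x ≠ 0) :
    ∃ u : ℕ → Fin d → ℝ, (∀ k, u k ≠ 0) ∧ Function.Injective fun k => householder (u k) *ᵥ x := by
  obtain ⟨i, hi⟩ := Function.ne_iff.mp hx
  have : Nontrivial (Fin d) := Fin.nontrivial_iff_two_le.mpr hd
  obtain ⟨j, hij⟩ := exists_ne i
  obtain ⟨σ, hσ, hσx⟩ : ∃ σ : ℝ, σ ≠ 0 ∧ 0 ≤ σ * (x i * x j) := by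
    rcases le_total 0 (x i * x j) with h | h
    · exact ⟨1, one_ne_zero, by linarith⟩
    · exact ⟨-1, by norm_num, by linarith⟩
  let u : ℕ → Fin d → ℝ := fun k => Pi.single i 1 + Pi.single j (k * σ)
  have hui : ∀ k, u k i = 1 := fun k => by simp [u, hij.symm]
  have huj : ∀ k, u k j = k * σ := fun k => by simp [u, hij]
  have hu0 : ∀ k, u k ≠ 0 := fun k h => by simpa [hui] using congrFun h i
  have hux : ∀ k, u k ⬝ᵥ x ≠ 0 := fun k h => by
    have h1 : u k ⬝ᵥ x = x i + k * σ * x j := by simp [u, add_dotProduct]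
    rw [h1] at h
    have h2 : x i * x i + k * (σ * (x i * x j)) = 0 := by linear_combination x i * h
    have h3 : 0 < x i * x i := mul_self_pos.mpr hi
    have h4 : 0 ≤ (k : ℝ) * (σ * (x i * x j)) := by positivity
    linarith
  refine ⟨u, hu0, fun k l hkl => ?_⟩
  simp only [householder_mulVec] at hkl
  have hki := congrFun hkl i
  have hkj := congrFun hkl j
  simp only [Pi.sub_apply, Pi.smul_apply, hui, huj, smul_eq_mul, mul_one, sub_right_inj]
    at hki hkj
  rw [hki] at hkj
  have hne : 2 * (u l ⬝ᵥ x) / (u l ⬝ᵥ u l) ≠ 0 :=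
    div_ne_zero (mul_ne_zero two_ne_zero (hux l)) (by simpa using hu0 l)
  exact_mod_cast mul_right_cancel₀ hσ (mul_left_cancel₀ hne hkj)

/-- The orbit of a nonzero vector under `SO(d)` is infinite for `d ≥ 2`. -/
lemma exists_injective_rotateVec {d : ℕ} (hd : 2 ≤ d) {n : Space d} (hn : n ≠ 0) :
    ∃ g : ℕ → SO d, Function.Injective fun k => rotateVec (g k) n := by
  have hn' : n.ofLp ≠ 0 := by simpa using hn
  have hx : (householder n.ofLp).mulVec n.ofLp ≠ 0 := by
    intro h
    have h1 := congrArg (householder n.ofLp).transpose.mulVec h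
    rw [Matrix.mulVec_mulVec, householder_transpose_mul hn', Matrix.one_mulVec,
      Matrix.mulVec_zero] at h1
    exact hn' h1
  obtain ⟨u, hu, hinj⟩ := exists_injective_householder hd hx
  -- A fixed second reflection corrects the determinant to `1`.
  refine ⟨fun k => reflectionPair (hu k) hn', fun k l hkl => hinj ?_⟩
  simpa [rotateVec, reflectionPair, Matrix.mulVec_mulVec] using hkl

lemma continuous_rotateVec {d : ℕ} (w : Space d) : Continuous fun ρ : SO d => rotateVec ρ w := by
  refine (PiLp.continuous_toLp 2 _).comp ?_
  exact continuous_subtype_val.matrix_mulVec continuous_const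

/-- Left translation gives the fibres over all orbit points of `n` equal measure. They are disjoint
and infinitely many, while Haar measure is finite. -/
lemma rotationMeasure_rotateVec_eq {d : ℕ} (hd : 2 ≤ d) {n : Space d} (hn : n ≠ 0) (w : Space d) :
    rotationMeasure d {ρ | rotateVec ρ w = n} = 0 := by
  obtain ⟨g, hg⟩ := exists_injective_rotateVec hd hn
  let B : Space d → Set (SO d) := fun y => {ρ | rotateVec ρ w = y}
  have hB : ∀ y, MeasurableSet (B y) := fun y =>
    (isClosed_eq (continuous_rotateVec w) continuous_const).measurableSet
  have hmeas : ∀ k, Measure.haar (B (rotateVec (g k) n)) = Measure.haar (B n) := fun k => by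
    rw [← measure_preimage_mul Measure.haar (g k) (B (rotateVec (g k) n))]
    congr 1
    ext ρ
    simp only [B, Set.mem_preimage, Set.mem_ofPred_eq, rotateVec_mul]
    constructor
    · intro h
      have h1 := congrArg (rotateVec (g k)⁻¹) h
      rwa [← rotateVec_mul, ← rotateVec_mul, inv_mul_cancel, one_mul, ← rotateVec_mul,
        inv_mul_cancel, rotateVec_one] at h1
    · rintro rfl
      rfl
  by_contra hpos
  have hpos' : 0 < (Measure.haar : Measure (SO d)) (B n) := pos_iff_ne_zero.mpr hpos
  have hfin := Measure.finite_const_le_meas_of_disjoint_iUnion (Measure.haar : Measure (SO d))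
    hpos' (As := fun k => B (rotateVec (g k) n)) (fun k => hB _) (fun k l hkl => by
      rw [Function.onFun, Set.disjoint_left]
      intro ρ h1 h2
      exact hkl (hg ((h1 : rotateVec ρ w = _).symm.trans h2))) (measure_ne_top _ _)
  refine Set.infinite_univ (α := ℕ) (hfin.subset fun k _ => ?_)
  exact (hmeas k).ge

theorem ae_not_separated_distanceSet_rotate {d : ℕ} (hd : 2 ≤ d) {S : Set (Space d)}
    (hS : WellDistributed S) {K : Set (Space d)} (hK : IsSymmetricConvexBody K) :
    ∀ᵐ ρ ∂(rotationMeasure d), ¬ Separated (distanceSet K (rotate ρ S)) := by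
  have : Nontrivial (Space d) := by
    have : Nonempty (Fin d) := ⟨⟨0, by omega⟩⟩
    infer_instance
  obtain ⟨A, hA, hSA⟩ := hS.exists_norm_sub_le
  obtain ⟨n, hn⟩ := hK.gaugeGradients_nonempty
  have hn0 := hK.ne_zero_of_mem_gaugeGradients hn
  have hnull : ∀ᵐ ρ ∂(rotationMeasure d), ∀ k : ℕ,
      ∀ w ∈ {w ∈ gapVectors S (1 / ((k : ℝ) + 1)) | ‖w‖ = ‖n‖}, rotateVec ρ w ≠ n := by
    rw [ae_all_iff]
    intro k
    rw [ae_ball_iff (finite_gapVectors_norm_eq hA hSA (by positivity)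
      (norm_pos_iff.mpr hn0)).countable]
    intro w _
    rw [ae_iff]
    simpa using rotationMeasure_rotateVec_eq hd hn0 w
  filter_upwards [hnull] with ρ hρ
  rintro ⟨c, hc, hsep⟩
  -- Gaps `1/(k+1)` suffice, which keeps the exceptional set a countable union.
  obtain ⟨k, hk⟩ := exists_nat_one_div_lt hc
  have hgap := gaugeGradients_subset_gapVectors (exists_norm_sub_le_rotate hSA ρ)
    (fun a ha a' ha' hne => hk.le.trans (hsep a ha a' ha' hne)) hn
  exact hρ k _ ⟨rotateVec_inv_mem_gapVectors hgap, norm_rotateVec _ _⟩ (rotateVec_rotateVec_inv ρ n)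

/-! ### Surface measure of a polytope and the conclusion of (i). -/

section Body

variable {d : ℕ} {K : Set (Space d)}

lemma IsSymmetricConvexBody.mem_frontier_iff (hK : IsSymmetricConvexBody K) {x : Space d} :
    x ∈ frontier K ↔ gauge K x = 1 :=
  (gauge_eq_one_iff_mem_frontier hK.convex hK.mem_nhds_zero).symm

/-- The boundary is covered by finitely many bounded pieces of hyperplanes. -/
lemma IsSymmetricConvexBody.isFiniteMeasure_surfaceMeasure [Nontrivial (Space d)]
    (hd : 1 ≤ d) (hK : IsSymmetricConvexBody K) (hfin : (gaugeGradients K).Finite) :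
    IsFiniteMeasure (surfaceMeasure K) := by
  refine ⟨?_⟩
  rw [surfaceMeasure, Measure.restrict_apply_univ]
  have hsub : frontier K ⊆ ⋃ n ∈ gaugeGradients K, {x | inner ℝ n x = 1} ∩ frontier K := by
    intro x hx
    obtain ⟨n, hn, hnx⟩ := hK.exists_gauge_eq_inner hfin x
    rw [hK.mem_frontier_iff.mp hx] at hnx
    exact Set.mem_biUnion hn ⟨hnx.symm, hx⟩
  refine (measure_mono hsub).trans_lt (measure_biUnion_lt_top hfin fun n hn => ?_)
  exact euclideanHausdorffMeasure_hyperplane_inter_lt_top hd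
    (hK.ne_zero_of_mem_gaugeGradients hn) 1
    (hK.isBounded.closure.subset frontier_subset_closure)

/-- If the norm has finitely many gradients, some facet has positive surface measure, so the Fourier
transform of the surface measure does not tend to zero in the direction normal to the facet. -/
lemma IsSymmetricConvexBody.exists_not_tendsto_surfaceFourier [Nontrivial (Space d)]
    (hd : 1 ≤ d) (hK : IsSymmetricConvexBody K) (hfin : (gaugeGradients K).Finite) :
    ∃ n ≠ 0, ¬ Tendsto (fun k : ℕ => surfaceFourier K ((k / 4 : ℝ) • n)) atTop (𝓝 0) := by
  have hfinite := hK.isFiniteMeasure_surfaceMeasure hd hfin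
  obtain ⟨n, hn, x, hx, r, hr, hball⟩ := hK.exists_flat_ball hfin
  have hn0 := hK.ne_zero_of_mem_gaugeGradients hn
  refine ⟨n, hn0, fun hlim => ?_⟩
  have hb : ∀ᵐ y ∂(surfaceMeasure K), |inner ℝ n y| ≤ 1 := by
    rw [surfaceMeasure]
    filter_upwards [ae_restrict_mem isClosed_frontier.measurableSet] with y hy
    have h1 := hK.inner_le_gauge hn y
    have h2 := hK.inner_le_gauge hn (-y)
    rw [gauge_neg hK.neg_mem, inner_neg_right] at h2
    rw [hK.mem_frontier_iff.mp hy] at h1 h2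
    exact abs_le.mpr ⟨by linarith, h1⟩
  have hzero := measure_level_eq_zero (surfaceMeasure K) (φ := fun y => inner ℝ n y)
    (by fun_prop) hb (hlim.congr fun k => by
      simp only [surfaceFourier, inner_smul_right, real_inner_comm n])
  refine absurd hzero (ne_of_gt ?_)
  rw [surfaceMeasure, Measure.restrict_apply (isClosed_eq (by fun_prop)
    continuous_const).measurableSet]
  refine (euclideanHausdorffMeasure_hyperplane_inter_ball_pos hd (x₀ := x) hn0 hr).trans_le
    (measure_mono ?_)
  rintro y ⟨hy1, hy2⟩
  have hy1 : inner ℝ n y = 1 := hy1.trans hx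
  exact ⟨hy1, hK.mem_frontier_iff.mpr ((hball y hy2).trans hy1)⟩

end Body

theorem not_separated_distanceSet_of_surfaceFourier_tendsto {d : ℕ} (hd : 1 ≤ d)
    {S : Set (Space d)} (hS : WellDistributed S) {K : Set (Space d)}
    (hK : IsSymmetricConvexBody K)
    (hdecay : ∀ n : Space d, n ≠ 0 →
      Tendsto (fun k : ℕ => surfaceFourier K ((k / 4 : ℝ) • n)) atTop (𝓝 0)) :
    ¬ Separated (distanceSet K S) := by
  rintro ⟨c, hc, hsep⟩
  have : Nontrivial (Space d) := by
    have : Nonempty (Fin d) := ⟨⟨0, by omega⟩⟩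
    infer_instance
  obtain ⟨A, hA, hSA⟩ := hS.exists_norm_sub_le
  have hfin := hK.finite_gaugeGradients hA hSA hc (gaugeGradients_subset_gapVectors hSA hsep)
  obtain ⟨n, hn, h⟩ := hK.exists_not_tendsto_surfaceFourier hd hfin
  exact h (hdecay n hn)

/-- Convexity and `γ 0 = 0` give `γ t ≤ t * γ 1` on `[0, 1]`, hence decay of order `1/|ξ|`. -/
lemma tendsto_of_norm_le_convex {d : ℕ} {F : Space d → ℂ} {γ : ℝ → ℝ} {C : ℝ}
    (hconv : ConvexOn ℝ (Set.Ici 0) γ) (hmono : MonotoneOn γ (Set.Ici 0)) (h0 : γ 0 = 0)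
    (hF : ∀ ξ : Space d, ξ ≠ 0 → ‖F ξ‖ ≤ C * γ (‖ξ‖⁻¹)) {n : Space d} (hn : n ≠ 0) :
    Tendsto (fun k : ℕ => F ((k / 4 : ℝ) • n)) atTop (𝓝 0) := by
  have hscale : Tendsto (fun k : ℕ => ‖((k / 4 : ℝ) • n)‖⁻¹) atTop (𝓝 0) := by
    have h1 : ∀ k : ℕ, ‖((k / 4 : ℝ) • n)‖⁻¹ = (k : ℝ)⁻¹ * (4 * ‖n‖⁻¹) := fun k => by
      rw [norm_smul, Real.norm_of_nonneg (by positivity), mul_inv, inv_div]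
      ring
    simp only [h1]
    simpa using (tendsto_inv_atTop_nhds_zero_nat (𝕜 := ℝ)).mul_const (4 * ‖n‖⁻¹)
  have hbound : Tendsto (fun k : ℕ => |C| * (‖((k / 4 : ℝ) • n)‖⁻¹ * γ 1)) atTop (𝓝 0) := by
    simpa using (hscale.mul_const (γ 1)).const_mul |C|
  refine squeeze_zero_norm' ?_ hbound
  filter_upwards [hscale.eventually_le_const (zero_lt_one' ℝ), eventually_gt_atTop 0] with k hk hk0
  set t := ‖((k / 4 : ℝ) • n)‖⁻¹ with ht
  have ht0 : 0 ≤ t := by positivity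
  have hne : (k / 4 : ℝ) • n ≠ 0 := smul_ne_zero (by positivity) hn
  have h1 : γ t ≤ t * γ 1 := by
    have h2 := hconv.2 (Set.mem_Ici.mpr le_rfl) (Set.mem_Ici.mpr zero_le_one)
      (sub_nonneg.mpr hk) ht0 (sub_add_cancel 1 t)
    simpa [h0] using h2
  have h3 : 0 ≤ γ t := h0 ▸ hmono (by simp) ht0 ht0
  calc ‖F ((k / 4 : ℝ) • n)‖ ≤ C * γ t := hF _ hne
    _ ≤ |C| * γ t := by gcongr; exact le_abs_self C
    _ ≤ |C| * (t * γ 1) := by gcongr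

end KDistance

end

theorem corollary0p5 (d : ℕ) (hd : 2 ≤ d) (S : Set (KDistance.Space d))
    (hS : KDistance.WellDistributed S) (hS' : KDistance.Separated S) :
    (∀ K : Set (KDistance.Space d), KDistance.IsSymmetricConvexBody K →
      ∀ (γ : ℝ → ℝ) (C : ℝ), ConvexOn ℝ (Set.Ici 0) γ → MonotoneOn γ (Set.Ici 0) → γ 0 = 0 →
        (∀ ξ : KDistance.Space d, ξ ≠ 0 →
          ‖KDistance.surfaceFourier K ξ‖ ≤ C * γ (‖ξ‖⁻¹)) →
        ¬ KDistance.Separated (KDistance.distanceSet K S)) ∧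
    (∀ K : Set (KDistance.Space d), KDistance.IsSymmetricConvexBody K →
      ∀ᵐ ρ ∂(KDistance.rotationMeasure d),
        ¬ KDistance.Separated (KDistance.distanceSet K (KDistance.rotate ρ S))) :=
  ⟨fun _ hK _ _ hconv hmono h0 hF =>
    KDistance.not_separated_distanceSet_of_surfaceFourier_tendsto (by omega) hS hK
      fun _ hn => KDistance.tendsto_of_norm_le_convex hconv hmono h0 hF hn,
    fun _ hK => KDistance.ae_not_separated_distanceSet_rotate hd hS hK⟩
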